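/- Theorem 3. Let $\lambda,\mu>0$, $\rho=\lambda/\mu$ and $\epsilon\in[0,1)$. Let $\mathcal U$ and $\mathcal V$ be finite alphabets of the same size. A source generates i.i.d. symbols $U_1,U_2,\dots$ with values in $\mathcal U$ and a common non-deterministic law (no symbol has probability $1$); the symbol $U_j$ is generated at time $j/\lambda$. A memoryless erasure channel EC$(\epsilon)$ with input alphabet $\mathcal V$ is used at the times $i/\mu$, $i=1,2,\dots$; each input is erased (output $?$) with probability $\epsilon$, independently of the other uses and of the source, and is otherwise received correctly and instantaneously. There is no feedback. A coding scheme $\mathcal C=(f_i,g_i)_{i\ge1}$ consists of encoders $f_i:\mathcal U^{\lfloor i\rho\rfloor}\to\mathcal V$, where $f_i(U_1,\dots,U_{\lfloor i\rho\rfloor})$ is the input of the $i$-th channel use, and of decoders $g_i$ which map the first $i$ channel outputs either to the declaration of an erasure or to a pair $(\hat u,j)$ with $\hat u\in\mathcal U$, $1\le j\le\lfloor i\rho\rfloor$, where $\hat u$ is an estimate of $U_j$. The scheme has zero error if almost surely every estimate that is put out is correct. Its instantaneous age is $\Delta_{\epsilon,\mathcal C}(t)=t-u(t)$, where $u(t)$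 is the generation time of the most recently generated symbol that has been decoded at a channel use up to time $t$, and $u(t)=0$ if there is none. The scheme has average age $\Delta_{\epsilon,\mathcal C}\in[-\infty,\infty]$ if almost surely $\frac1\tau\int_0^\tau\Delta_{\epsilon,\mathcal C}(t)\,\mathrm dt\to\Delta_{\epsilon,\mathcal C}$ as $\tau\to\infty$. The optimal average age $\Delta_\epsilon$ is the infimum of $\Delta_{\epsilon,\mathcal C}$ over all zero-error coding schemes $\mathcal C$ that have an average age. Then: - if $\rho$ is irrational, $\displaystyle \Delta_\epsilon=\frac1{2\lambda}+\frac{1+\epsilon}{2\mu(1-\epsilon)}$; - if $\rho=\frac ml$ with $m,l\in\mathbb N$, $l\ne0$ and $\gcd(m,l)=1$, then $\displaystyle \Delta_\epsilon=\frac{l-1}{2l\lambda}+\frac{1+\epsilon}{2\mu(1-\epsilon)}$. Moreover, the infimum is attained by some zero-error coding scheme, and for every zero-error coding scheme $\mathcal C$, whether or not it has an average age, almost surely $\liminf_{\tau\to\infty}\frac1\tau\int_0^\tau\Delta_{\epsilon,\mathcal C}(t)\,\mathrm dt\ge\Delta_\epsilon$. -/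

import Mathlib

open Filter Topology MeasureTheory ProbabilityTheory

noncomputable section

/-- The number `⌊i T_c / T_s⌋ = ⌊i ρ⌋` of source symbols generated up to (and including) the
instant `i T_c` of the `i`-th channel use, where `ρ = T_c / T_s` is the utilization. -/
def numGenerated (ρ : ℝ) (i : ℕ) : ℕ := ⌊(i : ℝ) * ρ⌋₊

/-- A coding scheme `(f_i, g_i)_{i ≥ 1}` without feedback, for the source alphabet `U` and the
channel-input alphabet `V`. At the `i`-th channel use the encoder maps all source symbols generated
so far to one channel input; the decoder maps the first `i` channel outputs (`none` is the erasure
symbol `?`) to either `none` (it declares an erasure), or to an estimate of a source symbol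
together with the index of that symbol. Tuples are indexed from `0`: the entry `j` of a tuple of
source symbols is the `(j+1)`-st symbol, the entry `k` of a tuple of channel outputs is the
output of the `(k+1)`-st channel use. The members `enc 0` and `dec 0` are never used. -/
structure CodingScheme (U V : Type*) (ρ : ℝ) where
  enc : (i : ℕ) → (Fin (numGenerated ρ i) → U) → V
  dec : (i : ℕ) → (Fin i → Option V) → Option (U × Fin (numGenerated ρ i))

/-- The sample space: the sequence of source symbols (`ω.1 j` is the `(j+1)`-st symbol) and the
erasure pattern (`ω.2 k = true` if and only if the `(k+1)`-st channel use is erased). -/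
abbrev Sample (U : Type*) : Type _ := (ℕ → U) × (ℕ → Bool)

/-- The law of the system: the source symbols are i.i.d. with law `p`, the channel uses are erased
independently with probability `ε`, and erasures are independent of the source. -/
def systemLaw {U : Type*} [MeasurableSpace U] (p : Measure U) (ε : unitInterval) :
    Measure (Sample U) :=
  (Measure.infinitePi (fun _ : ℕ => p)).prod
    (Measure.infinitePi (fun _ : ℕ => bernoulliMeasure true false ε))

namespace CodingScheme

variable {U V : Type*} {ρ : ℝ}

/-- The first `i` outputs of the erasure channel. -/
def received (C : CodingScheme U V ρ) (ω : Sample U) (i : ℕ) : Fin i → Option V :=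
  fun k => if ω.2 k = true then none else some (C.enc ((k : ℕ) + 1) (fun j => ω.1 (j : ℕ)))

/-- What the decoder puts out at the `i`-th channel use. -/
def output (C : CodingScheme U V ρ) (ω : Sample U) (i : ℕ) :
    Option (U × Fin (numGenerated ρ i)) :=
  C.dec i (C.received ω i)

/-- The index (counted from `1`) of the source symbol decoded at the `i`-th channel use, and `0`
if an erasure is declared. -/
def decodedIndex (C : CodingScheme U V ρ) (ω : Sample U) (i : ℕ) : ℕ :=
  match C.output ω i with
  | none => 0
  | some (_, j) => (j : ℕ) + 1

/-- The index (counted from `1`) of the freshest source symbol decoded during the channel uses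
`1, …, n`, and `0` if there is none. -/
def freshestIndex (C : CodingScheme U V ρ) (ω : Sample U) (n : ℕ) : ℕ :=
  (Finset.Icc 1 n).sup (C.decodedIndex ω)

/-- Almost surely every symbol that the decoder puts out is the true one. -/
def ZeroError [MeasurableSpace U] (C : CodingScheme U V ρ) (p : Measure U) (ε : unitInterval) :
    Prop :=
  ∀ᵐ ω ∂(systemLaw p ε), ∀ i : ℕ, 1 ≤ i →
    ∀ (u : U) (j : Fin (numGenerated ρ i)), C.output ω i = some (u, j) → u = ω.1 j

/-- The instantaneous age `t - u(t)`. The `i`-th channel use takes place at time `i / μ`, hence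
`⌊t μ⌋` of them have taken place by time `t`; the `j`-th source symbol is generated at time
`j / λ`. Before the first symbol is decoded, `u(t) = 0`. -/
def age {lam mu : ℝ} (C : CodingScheme U V (lam / mu)) (ω : Sample U) (t : ℝ) : ℝ :=
  t - (C.freshestIndex ω ⌊t * mu⌋₊ : ℝ) / lam

/-- The time average `(1/τ) ∫₀^τ Δ(t) dt` of the age. -/
def timeAverage {lam mu : ℝ} (C : CodingScheme U V (lam / mu)) (ω : Sample U) (τ : ℝ) : ℝ :=
  1 / τ * ∫ t in (0 : ℝ)..τ, C.age ω t

/-- The average age of the scheme exists and is `a` (possibly `⊤`): almost surely,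
`(1/τ) ∫₀^τ Δ(t) dt` tends to `a` as `τ → ∞`. -/
def HasAverageAge [MeasurableSpace U] {lam mu : ℝ} (C : CodingScheme U V (lam / mu))
    (p : Measure U) (ε : unitInterval) (a : EReal) : Prop :=
  ∀ᵐ ω ∂(systemLaw p ε), Tendsto (fun τ : ℝ => (C.timeAverage ω τ : EReal)) atTop (𝓝 a)

end CodingScheme

/-- The optimal average age: the infimum of the average ages of all coding schemes with zero error
probability. -/
def optimalAverageAge (U V : Type*) [MeasurableSpace U] (p : Measure U) (ε : unitInterval)
    (lam mu : ℝ) : EReal :=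
  sInf {a : EReal | ∃ C : CodingScheme U V (lam / mu), C.ZeroError p ε ∧ C.HasAverageAge p ε a}

end

/-!
Until the next unerased channel use, the outputs depend only on the symbols generated by the last
unerased one. A later symbol is independent of them and is not deterministic, so a decoder that
never errs cannot put it out. Hence no scheme does better than sending the freshest symbol uncoded,
which delivers a symbol at every unerased use.

Sampled at the channel uses, the age of that scheme grows by `1 / μ` at an erasure and otherwise
drops to the delay `{n ρ} / λ` of the freshest symbol. Its innovations are orthogonal and bounded in
`L²`, so they average to `0` almost surely, and the recursion then expresses the mean age through
the mean of `{n ρ}`. The latter is `(l - 1) / (2 l)` for `ρ = m / l` in lowest terms, and `1 / 2`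
for irrational `ρ`: by Dirichlet, `ρ` is so close to some `m / l` with `l` large that over any `l`
consecutive terms the mean of `{n ρ}` is nearly that of `{n m / l}`.
-/

/-- `x` has Cesàro mean `L`: the averages of its first `N` terms tend to `L`. -/
def HasCesaroMean (x : ℕ → ℝ) (L : ℝ) : Prop :=
  Tendsto (fun N : ℕ => (∑ n ∈ Finset.range N, x n) / N) atTop (𝓝 L)

namespace HasCesaroMean

variable {x y : ℕ → ℝ} {L M : ℝ}

lemma add (hx : HasCesaroMean x L) (hy : HasCesaroMean y M) :
    HasCesaroMean (fun n => x n + y n) (L + M) :=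
  (Tendsto.add hx hy).congr fun N => by rw [Finset.sum_add_distrib, add_div]

lemma const_mul (c : ℝ) (hx : HasCesaroMean x L) : HasCesaroMean (fun n => c * x n) (c * L) :=
  (Tendsto.const_mul c hx).congr fun N => by rw [← Finset.mul_sum, mul_div_assoc]

lemma sub (hx : HasCesaroMean x L) (hy : HasCesaroMean y M) :
    HasCesaroMean (fun n => x n - y n) (L - M) :=
  (Tendsto.sub hx hy).congr fun N => by rw [Finset.sum_sub_distrib, sub_div]

end HasCesaroMean

lemma hasCesaroMean_const (c : ℝ) : HasCesaroMean (fun _ => c) c := by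
  refine tendsto_const_nhds.congr' ?_
  filter_upwards [eventually_ne_atTop 0] with N hN
  rw [Finset.sum_const, Finset.card_range, nsmul_eq_mul, mul_div_cancel_left₀ _ (by positivity)]

lemma hasCesaroMean_succ_sub {x : ℕ → ℝ} (hx : Tendsto (fun N : ℕ => x N / N) atTop (𝓝 0)) :
    HasCesaroMean (fun n => x (n + 1) - x n) 0 := by
  have h := hx.sub (tendsto_const_div_atTop_nhds_zero_nat (x 0))
  rw [sub_zero] at h
  exact h.congr fun N => by rw [Finset.sum_range_sub, sub_div]

lemma abs_sum_range_le_of_blocks {f : ℕ → ℝ} {B η : ℝ} {q : ℕ} (hη : 0 ≤ η) (hq : 0 < q)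
    (hf : ∀ n, |f n| ≤ B) (hblock : ∀ k, |∑ j ∈ Finset.range q, f (k + j)| ≤ η * q) (N : ℕ) :
    |∑ n ∈ Finset.range N, f n| ≤ η * N + q * B := by
  induction N using Nat.strong_induction_on with
  | _ N ih =>
    rcases lt_or_ge N q with hN | hN
    · have hB : 0 ≤ B := (abs_nonneg _).trans (hf 0)
      calc |∑ n ∈ Finset.range N, f n|
          ≤ ∑ n ∈ Finset.range N, |f n| := Finset.abs_sum_le_sum_abs _ _
        _ ≤ ∑ _n ∈ Finset.range N, B := Finset.sum_le_sum fun n _ => hf n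
        _ = N * B := by simp
        _ ≤ q * B := by gcongr
        _ ≤ η * N + q * B := le_add_of_nonneg_left (by positivity)
    · obtain ⟨M, rfl⟩ := Nat.exists_eq_add_of_le' hN
      rw [Finset.sum_range_add]
      calc |∑ n ∈ Finset.range M, f n + ∑ j ∈ Finset.range q, f (M + j)|
          ≤ |∑ n ∈ Finset.range M, f n| + |∑ j ∈ Finset.range q, f (M + j)| := abs_add_le _ _
        _ ≤ (η * M + q * B) + η * q := add_le_add (ih M (by omega)) (hblock M)
        _ = η * (M + q : ℕ) + q * B := by push_cast; ring

lemma hasCesaroMean_of_blocks {x : ℕ → ℝ} {L B : ℝ} (hx : ∀ n, |x n - L| ≤ B)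
    (h : ∀ η : ℝ, 0 < η → ∃ q : ℕ, 0 < q ∧
      ∀ k, |∑ j ∈ Finset.range q, (x (k + j) - L)| ≤ η * q) :
    HasCesaroMean x L := by
  rw [HasCesaroMean, Metric.tendsto_atTop']
  intro η hη
  obtain ⟨q, hq, hblock⟩ := h (η / 2) (half_pos hη)
  obtain ⟨N₀, hN₀⟩ := exists_nat_gt (q * B / (η / 2))
  refine ⟨N₀, fun N hN => ?_⟩
  have hN0 : (0 : ℝ) < N := by exact_mod_cast (Nat.zero_le _).trans_lt hN
  have hqN : q * B < η / 2 * N := by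
    rw [div_lt_iff₀' (half_pos hη)] at hN₀
    exact hN₀.trans (by gcongr)
  have hmean : (∑ n ∈ Finset.range N, x n) / N - L = (∑ n ∈ Finset.range N, (x n - L)) / N := by
    rw [Finset.sum_sub_distrib, Finset.sum_const, Finset.card_range, nsmul_eq_mul]
    field_simp
  rw [Real.dist_eq, hmean, abs_div, abs_of_pos hN0, div_lt_iff₀ hN0]
  linarith [abs_sum_range_le_of_blocks (half_pos hη).le hq hx hblock N]

lemma sum_range_emod_add_mul {M : Type*} [AddCommMonoid M] {p : ℤ} {q : ℕ}
    (hpq : IsCoprime p (q : ℤ)) (a : ℤ) (g : ℤ → M) :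
    ∑ j ∈ Finset.range q, g ((a + j * p) % q) = ∑ j ∈ Finset.range q, g j := by
  have hnonneg : ∀ j ∈ Finset.range q, 0 ≤ (a + j * p) % q := fun j hj =>
    Int.emod_nonneg _ (by have := Finset.mem_range.1 hj; omega)
  have hmaps : ∀ j ∈ Finset.range q, ((a + j * p) % q).toNat ∈ Finset.range q := by
    intro j hj
    have hjq := Finset.mem_range.1 hj
    have hlt := Int.emod_lt_of_pos (a + j * p) (b := q) (by omega)
    have h₀ := hnonneg j hj
    rw [Finset.mem_range]
    omega
  have hinj : Set.InjOn (fun j : ℕ => ((a + j * p) % q).toNat) (Finset.range q) := by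
    intro i hi j hj hij
    have hmod : a + i * p ≡ a + j * p [ZMOD q] := by
      have h := congrArg (Nat.cast (R := ℤ)) hij
      simp only [Int.toNat_of_nonneg (hnonneg _ hi), Int.toNat_of_nonneg (hnonneg _ hj)] at h
      exact h
    have hdvd : (q : ℤ) ∣ j - i := by
      refine hpq.symm.dvd_of_dvd_mul_right ?_
      simpa only [add_sub_add_left_eq_sub, ← sub_mul] using hmod.dvd
    exact Nat.ModEq.eq_of_lt_of_lt ((Int.natCast_modEq_iff).1 (Int.modEq_iff_dvd.2 hdvd))
      (Finset.mem_range.1 hi) (Finset.mem_range.1 hj)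
  refine Finset.sum_nbij _ hmaps hinj
    (Finset.surjOn_of_injOn_of_card_le _ hmaps hinj le_rfl) fun j hj => ?_
  rw [Int.toNat_of_nonneg (hnonneg j hj)]

lemma fract_add_div_natCast {q : ℕ} (hq : 0 < q) (z : ℤ) {θ : ℝ} (hθ₀ : 0 ≤ θ) (hθ₁ : θ < 1) :
    Int.fract ((z + θ) / q) = ((z % q : ℤ) + θ) / q := by
  have hq' : (0 : ℝ) < q := by exact_mod_cast hq
  have hnonneg : (0 : ℝ) ≤ (z % q : ℤ) := by exact_mod_cast Int.emod_nonneg z (by omega)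
  have hlt : ((z % q : ℤ) : ℝ) + 1 ≤ q := by
    exact_mod_cast Int.emod_lt_of_pos z (by omega : (0 : ℤ) < q)
  refine Int.fract_eq_iff.2 ⟨by positivity, ?_, z / q, ?_⟩
  · rw [div_lt_one hq']
    linarith
  · have hz : (z : ℝ) = (z % q : ℤ) + q * (z / q : ℤ) := by
      exact_mod_cast (Int.emod_add_mul_ediv z q).symm
    field_simp
    linarith

/-- Hermite's identity for the rotation by a rational number. -/
lemma sum_fract_add_mul_ratCast (r : ℚ) (x : ℝ) :
    ∑ j ∈ Finset.range r.den, Int.fract (x + j * (r : ℝ)) =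
      Int.fract (r.den * x) + ((r.den : ℝ) - 1) / 2 := by
  have hq : (r.den : ℝ) ≠ 0 := by exact_mod_cast r.den_ne_zero
  have hterm : ∀ j : ℕ, Int.fract (x + j * (r : ℝ)) =
      (((⌊r.den * x⌋ + j * r.num) % r.den : ℤ) + Int.fract (r.den * x)) / r.den := by
    intro j
    rw [← fract_add_div_natCast r.den_pos _ (Int.fract_nonneg _) (Int.fract_lt_one _)]
    congr 1
    rw [← Int.self_sub_floor, Rat.cast_def]
    push_cast
    field_simp
    ring
  have hcop : IsCoprime r.num (r.den : ℤ) := Rat.isCoprime_num_den r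
  have hgauss : (∑ j ∈ Finset.range r.den, (j : ℝ)) = r.den * ((r.den : ℝ) - 1) / 2 := by
    have h := congrArg (Nat.cast (R := ℝ)) (Finset.sum_range_id_mul_two r.den)
    push_cast [Nat.cast_pred r.den_pos] at h
    exact (eq_div_iff two_ne_zero).2 h
  simp_rw [hterm]
  rw [sum_range_emod_add_mul hcop _ fun z : ℤ => ((z : ℝ) + Int.fract (r.den * x)) / r.den,
    ← Finset.sum_div, Finset.sum_add_distrib]
  simp only [Int.cast_natCast, hgauss, Finset.sum_const, Finset.card_range, nsmul_eq_mul]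
  field_simp
  ring

lemma hasCesaroMean_fract_mul_ratCast (r : ℚ) :
    HasCesaroMean (fun n => Int.fract (n * (r : ℝ))) (((r.den : ℝ) - 1) / (2 * r.den)) := by
  have : (1 : ℝ) ≤ r.den := by exact_mod_cast r.den_pos
  refine hasCesaroMean_of_blocks (B := 1 + |((r.den : ℝ) - 1) / (2 * r.den)|) (fun n => ?_)
    fun η hη => ⟨r.den, r.den_pos, fun k => ?_⟩
  · refine (abs_sub _ _).trans ?_
    gcongr
    exact Int.abs_fract.trans_le (Int.fract_lt_one _).le
  · have hperiod : Int.fract (r.den * ((k : ℝ) * r)) = 0 := by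
      rw [Int.fract_eq_zero_iff, mul_left_comm, Rat.cast_def, mul_div_cancel₀ _ (by positivity)]
      exact ⟨k * r.num, by push_cast; ring⟩
    have hsum := sum_fract_add_mul_ratCast r (k * r)
    simp only [Finset.sum_sub_distrib, Nat.cast_add, add_mul, hsum, hperiod, Finset.sum_const,
      Finset.card_range, nsmul_eq_mul]
    have hmean : 0 + ((r.den : ℝ) - 1) / 2 - r.den * ((r.den - 1) / (2 * r.den)) = 0 := by
      field_simp
      ring
    rw [hmean, abs_zero]
    positivity

lemma fract_add_le_of_nonneg (x : ℝ) {d : ℝ} (hd : 0 ≤ d) : Int.fract (x + d) ≤ Int.fract x + d :=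
  (Int.fract_add_le x d).trans
    (add_le_add_right (sub_le_self d (Int.cast_nonneg (Int.floor_nonneg.2 hd))) _)

/-- The points `x + j ρ` are within `1 / q` of the points `x + j r`, where `q` is the denominator
of `r`, and the sum over the latter is given by Hermite's identity. -/
lemma abs_sum_fract_add_mul_sub_half_le {ρ : ℝ} {r : ℚ} (h : |ρ - r| ≤ 1 / (r.den : ℝ) ^ 2)
    (x : ℝ) :
    |∑ j ∈ Finset.range r.den, (Int.fract (x + j * ρ) - 1 / 2)| ≤ 5 / 2 := by
  have hq : (0 : ℝ) < r.den := by exact_mod_cast r.den_pos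
  have hclose : ∀ j ∈ Finset.range r.den, |j * (ρ - r)| ≤ 1 / (r.den : ℝ) := by
    intro j hj
    have hj' : (j : ℝ) ≤ r.den := by exact_mod_cast (Finset.mem_range.1 hj).le
    calc |j * (ρ - r)| = j * |ρ - r| := by rw [abs_mul, Nat.abs_cast]
      _ ≤ r.den * (1 / (r.den : ℝ) ^ 2) := by gcongr
      _ = 1 / (r.den : ℝ) := by field_simp
  have hupper : ∀ j ∈ Finset.range r.den, Int.fract (x + j * ρ) ≤
      Int.fract (x - 1 / r.den + j * (r : ℝ)) + 2 / r.den := by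
    intro j hj
    obtain ⟨h₁, h₂⟩ := abs_le.1 (hclose j hj)
    have := fract_add_le_of_nonneg (x - 1 / r.den + j * (r : ℝ)) (d := 1 / r.den + j * (ρ - r))
      (by linarith)
    rw [show x - 1 / r.den + j * (r : ℝ) + (1 / r.den + j * (ρ - r)) = x + j * ρ by ring] at this
    linarith [add_div 1 1 (r.den : ℝ)]
  have hlower : ∀ j ∈ Finset.range r.den, Int.fract (x + 1 / r.den + j * (r : ℝ)) - 2 / r.den ≤
      Int.fract (x + j * ρ) := by
    intro j hj
    obtain ⟨h₁, h₂⟩ := abs_le.1 (hclose j hj)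
    have := fract_add_le_of_nonneg (x + j * ρ) (d := 1 / r.den - j * (ρ - r)) (by linarith)
    rw [show x + j * ρ + (1 / r.den - j * (ρ - r)) = x + 1 / r.den + j * (r : ℝ) by ring] at this
    linarith [add_div 1 1 (r.den : ℝ)]
  have hsum_upper := Finset.sum_le_sum hupper
  have hsum_lower := Finset.sum_le_sum hlower
  rw [Finset.sum_add_distrib, sum_fract_add_mul_ratCast] at hsum_upper
  rw [Finset.sum_sub_distrib, sum_fract_add_mul_ratCast] at hsum_lower
  simp only [Finset.sum_sub_distrib, Finset.sum_const, Finset.card_range, nsmul_eq_mul,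
    mul_div_cancel₀ _ hq.ne'] at hsum_upper hsum_lower ⊢
  rw [abs_le]
  constructor <;>
  linarith [Int.fract_lt_one (r.den * (x - 1 / r.den)), Int.fract_nonneg (r.den * (x + 1 / r.den))]

lemma exists_rat_lt_den_abs_sub_le_of_irrational {ρ : ℝ} (hρ : Irrational ρ) (Q : ℕ) :
    ∃ r : ℚ, Q < r.den ∧ |ρ - r| ≤ 1 / (r.den : ℝ) ^ 2 := by
  have hlim : Tendsto (fun n : ℕ => (1 : ℝ) / n) atTop (𝓝 0) :=
    tendsto_const_div_atTop_nhds_zero_nat 1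
  obtain ⟨n, hfar, hn⟩ := ((hlim.eventually
    (hρ.eventually_forall_le_dist_cast_rat_of_den_le Q)).and (eventually_gt_atTop 0)).exists
  obtain ⟨r, hr, hrn⟩ := Real.exists_rat_abs_sub_le_and_den_le ρ hn
  have hq : (1 : ℝ) ≤ r.den := by exact_mod_cast r.den_pos
  have hn' : (0 : ℝ) < n := by exact_mod_cast hn
  have hrn' : (r.den : ℝ) ≤ n := by exact_mod_cast hrn
  refine ⟨r, ?_, hr.trans ?_⟩
  · by_contra! hrQ
    have hnear : |ρ - r| < 1 / n := by
      refine hr.trans_lt (one_div_lt_one_div_of_lt hn' ?_)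
      nlinarith
    exact hnear.not_ge (hfar r hrQ)
  · rw [sq]
    gcongr
    linarith

lemma hasCesaroMean_fract_mul_irrational {ρ : ℝ} (hρ : Irrational ρ) :
    HasCesaroMean (fun n => Int.fract (n * ρ)) (1 / 2) := by
  refine hasCesaroMean_of_blocks (B := 1) (fun n => ?_) fun η hη => ?_
  · rw [abs_le]
    constructor <;> linarith [Int.fract_nonneg (n * ρ), Int.fract_lt_one (n * ρ)]
  · obtain ⟨Q, hQ⟩ := exists_nat_gt (5 / 2 / η)
    obtain ⟨r, hQr, hr⟩ := exists_rat_lt_den_abs_sub_le_of_irrational hρ Q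
    refine ⟨r.den, r.den_pos, fun k => ?_⟩
    have hsmall : 5 / 2 ≤ η * r.den := by
      rw [div_lt_iff₀' hη] at hQ
      exact hQ.le.trans (by gcongr)
    simpa only [Nat.cast_add, add_mul] using
      (abs_sum_fract_add_mul_sub_half_le hr (k * ρ)).trans hsmall

section OrthogonalLaw

variable {Ω : Type*} [MeasurableSpace Ω] {P : Measure Ω} {C : ℝ}

lemma ae_tendsto_zero_of_summable_integral_sq {Y : ℕ → Ω → ℝ} (hY : ∀ k, MemLp (Y k) 2 P)
    (hsum : Summable fun k => ∫ ω, Y k ω ^ 2 ∂P) :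
    ∀ᵐ ω ∂P, Tendsto (fun k => Y k ω) atTop (𝓝 0) := by
  have hmeas : ∀ k, AEMeasurable (fun ω => ENNReal.ofReal (Y k ω ^ 2)) P := fun k =>
    ((hY k).aestronglyMeasurable.aemeasurable.pow_const 2).ennreal_ofReal
  have hfin : ∫⁻ ω, ∑' k, ENNReal.ofReal (Y k ω ^ 2) ∂P ≠ ⊤ := by
    rw [lintegral_tsum hmeas]
    simp_rw [← fun k => ofReal_integral_eq_lintegral_ofReal (hY k).integrable_sq
      (Eventually.of_forall fun ω => sq_nonneg (Y k ω))]
    exact hsum.tsum_ofReal_ne_top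
  filter_upwards [ae_lt_top' (AEMeasurable.tsum hmeas) hfin] with ω hω
  have hsq : Tendsto (fun k => Y k ω ^ 2) atTop (𝓝 0) := by
    have h := (ENNReal.tendsto_toReal ENNReal.zero_ne_top).comp
      (ENNReal.tendsto_atTop_zero_of_tsum_ne_top hω.ne)
    simpa only [Function.comp_def, ENNReal.toReal_ofReal (sq_nonneg _), ENNReal.toReal_zero] using h
  rw [tendsto_zero_iff_abs_tendsto_zero]
  simpa only [Function.comp_def, Real.sqrt_sq_eq_abs, Real.sqrt_zero] using
    (Real.continuous_sqrt.tendsto 0).comp hsq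

lemma ae_tendsto_zero_of_integral_sq_le {Y : ℕ → Ω → ℝ} (hY : ∀ k, MemLp (Y k) 2 P)
    (hC : ∀ k : ℕ, ∫ ω, Y k ω ^ 2 ∂P ≤ C / (k : ℝ) ^ 2) :
    ∀ᵐ ω ∂P, Tendsto (fun k => Y k ω) atTop (𝓝 0) := by
  refine ae_tendsto_zero_of_summable_integral_sq hY (Summable.of_nonneg_of_le
    (fun k => integral_nonneg fun ω => sq_nonneg _) hC ?_)
  simpa only [mul_one_div] using (Real.summable_one_div_nat_pow.2 one_lt_two).mul_left C

lemma memLp_div_const {f : Ω → ℝ} {q : ENNReal} (hf : MemLp f q P) (c : ℝ) :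
    MemLp (fun ω => f ω / c) q P := by
  simpa only [div_eq_mul_inv] using hf.mul_const c⁻¹

lemma integral_div_sq (f : Ω → ℝ) (c : ℝ) :
    ∫ ω, (f ω / c) ^ 2 ∂P = (∫ ω, f ω ^ 2 ∂P) / c ^ 2 := by
  simp_rw [div_pow, integral_div]

lemma integral_sum_sq_le_of_orthogonal {ι : Type*} {Y : ι → Ω → ℝ} (hY : ∀ n, MemLp (Y n) 2 P)
    (horth : Pairwise fun m n => ∫ ω, Y m ω * Y n ω ∂P = 0)
    (hC : ∀ n, ∫ ω, Y n ω ^ 2 ∂P ≤ C) (s : Finset ι) :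
    ∫ ω, (∑ n ∈ s, Y n ω) ^ 2 ∂P ≤ s.card * C := by
  have hint : ∀ m n, Integrable (fun ω => Y m ω * Y n ω) P :=
    fun m n => (hY m).integrable_mul (hY n)
  calc ∫ ω, (∑ n ∈ s, Y n ω) ^ 2 ∂P
      = ∑ m ∈ s, ∑ n ∈ s, ∫ ω, Y m ω * Y n ω ∂P := by
        simp_rw [sq, Finset.sum_mul_sum]
        rw [integral_finsetSum _ fun m _ => integrable_finsetSum _ fun n _ => hint m n]
        exact Finset.sum_congr rfl fun m _ => integral_finsetSum _ fun n _ => hint m n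
    _ = ∑ m ∈ s, ∫ ω, Y m ω ^ 2 ∂P := by
        refine Finset.sum_congr rfl fun m hm => ?_
        rw [Finset.sum_eq_single_of_mem m hm fun n _ hnm => horth hnm.symm]
        simp_rw [sq]
    _ ≤ s.card * C := by
        rw [← nsmul_eq_mul]
        exact Finset.sum_le_card_nsmul _ _ _ fun m _ => hC m

lemma integral_sum_abs_sq_le {ι : Type*} {Y : ι → Ω → ℝ} (hY : ∀ n, MemLp (Y n) 2 P)
    (hC : ∀ n, ∫ ω, Y n ω ^ 2 ∂P ≤ C) (s : Finset ι) :
    ∫ ω, (∑ n ∈ s, |Y n ω|) ^ 2 ∂P ≤ (s.card : ℝ) ^ 2 * C := by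
  have hsq : ∀ n, Integrable (fun ω => |Y n ω| ^ 2) P := fun n => (hY n).abs.integrable_sq
  calc ∫ ω, (∑ n ∈ s, |Y n ω|) ^ 2 ∂P
      ≤ ∫ ω, s.card * ∑ n ∈ s, |Y n ω| ^ 2 ∂P :=
        integral_mono (memLp_finsetSum s fun n _ => (hY n).abs).integrable_sq
          ((integrable_finsetSum _ fun n _ => hsq n).const_mul _) fun ω => sq_sum_le_card_mul_sum_sq
    _ = s.card * ∑ n ∈ s, ∫ ω, Y n ω ^ 2 ∂P := by
        rw [integral_const_mul, integral_finsetSum _ fun n _ => hsq n]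
        simp_rw [sq_abs]
    _ ≤ s.card * (s.card * C) := by
        gcongr
        rw [← nsmul_eq_mul]
        exact Finset.sum_le_card_nsmul _ _ _ fun m _ => hC m
    _ = (s.card : ℝ) ^ 2 * C := by ring

lemma hasCesaroMean_zero_of_squares {y : ℕ → ℝ}
    (hsq : Tendsto (fun k : ℕ => (∑ n ∈ Finset.range (k ^ 2), y n) / (k : ℝ) ^ 2) atTop (𝓝 0))
    (hgap : Tendsto (fun k : ℕ => (∑ n ∈ Finset.Ico (k ^ 2) ((k + 1) ^ 2), |y n|) / (k : ℝ) ^ 2)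
      atTop (𝓝 0)) :
    HasCesaroMean y 0 := by
  have hsqrt : Tendsto Nat.sqrt atTop atTop :=
    tendsto_atTop_atTop.2 fun k => ⟨k ^ 2, fun N hN => Nat.le_sqrt'.2 hN⟩
  have hlim := (hsq.abs.add hgap).comp hsqrt
  rw [abs_zero, add_zero] at hlim
  refine squeeze_zero_norm' ?_ hlim
  filter_upwards [hsqrt.eventually_gt_atTop 0] with N hN
  set k := N.sqrt
  have hk : (0 : ℝ) < (k : ℝ) ^ 2 := by positivity
  have hkN : k ^ 2 ≤ N := Nat.sqrt_le' N
  have hrest : |∑ n ∈ Finset.Ico (k ^ 2) N, y n| ≤ ∑ n ∈ Finset.Ico (k ^ 2) ((k + 1) ^ 2), |y n| :=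
    (Finset.abs_sum_le_sum_abs _ _).trans <| Finset.sum_le_sum_of_subset_of_nonneg
      (Finset.Ico_subset_Ico_right (Nat.lt_succ_sqrt' N).le) fun _ _ _ => abs_nonneg _
  rw [Real.norm_eq_abs, Function.comp_apply, abs_div, Nat.abs_cast, abs_div, abs_of_pos hk,
    ← add_div, ← Finset.sum_range_add_sum_Ico _ hkN]
  gcongr
  · exact (abs_add_le _ _).trans (by gcongr)
  · exact_mod_cast hkN

lemma ae_tendsto_sum_range_sq_div {Y : ℕ → Ω → ℝ} (hY : ∀ n, MemLp (Y n) 2 P)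
    (horth : Pairwise fun m n => ∫ ω, Y m ω * Y n ω ∂P = 0)
    (hC : ∀ n, ∫ ω, Y n ω ^ 2 ∂P ≤ C) :
    ∀ᵐ ω ∂P, Tendsto (fun k : ℕ => (∑ n ∈ Finset.range (k ^ 2), Y n ω) / (k : ℝ) ^ 2)
      atTop (𝓝 0) := by
  refine ae_tendsto_zero_of_integral_sq_le (C := C)
    (fun k => memLp_div_const (memLp_finsetSum _ fun n _ => hY n) _) fun k => ?_
  rcases eq_or_ne k 0 with rfl | hk
  · simp
  rw [integral_div_sq]
  calc _ ≤ ((k ^ 2 : ℕ) * C) / ((k : ℝ) ^ 2) ^ 2 := by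
        gcongr
        simpa only [Finset.card_range] using
          integral_sum_sq_le_of_orthogonal hY horth hC (Finset.range (k ^ 2))
    _ = C / (k : ℝ) ^ 2 := by
        push_cast
        field_simp

lemma ae_tendsto_sum_abs_Ico_sq_div {Y : ℕ → Ω → ℝ} (hY : ∀ n, MemLp (Y n) 2 P)
    (hC : ∀ n, ∫ ω, Y n ω ^ 2 ∂P ≤ C) :
    ∀ᵐ ω ∂P, Tendsto
      (fun k : ℕ => (∑ n ∈ Finset.Ico (k ^ 2) ((k + 1) ^ 2), |Y n ω|) / (k : ℝ) ^ 2)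
      atTop (𝓝 0) := by
  have hC₀ : 0 ≤ C := (integral_nonneg fun ω => sq_nonneg (Y 0 ω)).trans (hC 0)
  refine ae_tendsto_zero_of_integral_sq_le (C := 9 * C)
    (fun k => memLp_div_const (memLp_finsetSum _ fun n _ => (hY n).abs) _) fun k => ?_
  rcases eq_or_ne k 0 with rfl | hk
  · simp
  have hk₁ : (1 : ℝ) ≤ k := by exact_mod_cast Nat.one_le_iff_ne_zero.2 hk
  have hcard : (Finset.Ico (k ^ 2) ((k + 1) ^ 2)).card = 2 * k + 1 := by
    rw [Nat.card_Ico, Nat.sub_eq_iff_eq_add (by gcongr; omega)]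
    ring
  rw [integral_div_sq]
  calc _ ≤ ((2 * k + 1 : ℕ) : ℝ) ^ 2 * C / ((k : ℝ) ^ 2) ^ 2 := by
        gcongr
        exact hcard ▸ integral_sum_abs_sq_le hY hC (Finset.Ico (k ^ 2) ((k + 1) ^ 2))
    _ ≤ (3 * (k : ℝ)) ^ 2 * C / ((k : ℝ) ^ 2) ^ 2 := by
        gcongr
        push_cast
        linarith
    _ = 9 * C / (k : ℝ) ^ 2 := by
        field_simp
        ring

/-- Rajchman's strong law of large numbers. -/
theorem ae_hasCesaroMean_zero_of_orthogonal {Y : ℕ → Ω → ℝ} (hY : ∀ n, MemLp (Y n) 2 P)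
    (horth : Pairwise fun m n => ∫ ω, Y m ω * Y n ω ∂P = 0)
    (hC : ∀ n, ∫ ω, Y n ω ^ 2 ∂P ≤ C) :
    ∀ᵐ ω ∂P, HasCesaroMean (fun n => Y n ω) 0 := by
  filter_upwards [ae_tendsto_sum_range_sq_div hY horth hC, ae_tendsto_sum_abs_Ico_sq_div hY hC]
    with ω hsq hgap using hasCesaroMean_zero_of_squares hsq hgap

end OrthogonalLaw

section Prefix

variable {α β γ : Type*} {m n : ℕ}

lemma exists_eq_comp_restrict_of_dependsOn [Nonempty γ] {f : (ℕ → α) → γ}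
    (hf : DependsOn f (Set.Iio n)) :
    ∃ g : (Finset.range n → α) → γ, f = fun ω => g fun i => ω i :=
  dependsOn_iff_exists_comp.1 <| hf.mono fun _ hi => Finset.mem_coe.2 (Finset.mem_range.2 hi)

variable [MeasurableSpace α]

lemma measurable_prefix (n : ℕ) :
    Measurable fun (ω : ℕ → α) (i : Finset.range n) => ω i :=
  measurable_pi_lambda _ fun i => measurable_pi_apply (i : ℕ)

lemma memLp_of_dependsOn [Finite α] [MeasurableSingletonClass α] {P : Measure (ℕ → α)}
    [IsFiniteMeasure P] {q : ENNReal} {f : (ℕ → α) → ℝ} (hf : DependsOn f (Set.Iio n)) :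
    MemLp f q P := by
  obtain ⟨g, rfl⟩ := exists_eq_comp_restrict_of_dependsOn hf
  obtain ⟨C, hC⟩ := (Set.finite_range fun x => ‖g x‖).bddAbove
  exact MemLp.of_bound
    ((Measurable.of_discrete (f := g)).comp (measurable_prefix n)).aestronglyMeasurable C
    (Eventually.of_forall fun ω => hC ⟨_, rfl⟩)

variable [Countable α] [MeasurableSingletonClass α]

lemma measurable_of_dependsOn [MeasurableSpace γ] [Nonempty γ] {f : (ℕ → α) → γ}
    (hf : DependsOn f (Set.Iio n)) : Measurable f := by
  obtain ⟨g, rfl⟩ := exists_eq_comp_restrict_of_dependsOn hf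
  exact (Measurable.of_discrete (f := g)).comp (measurable_prefix n)

lemma measurable_of_dependsOn_of_dependsOn [Countable β] [MeasurableSpace β]
    [MeasurableSingletonClass β] [MeasurableSpace γ] [Nonempty γ] {F : (ℕ → α) → (ℕ → β) → γ}
    (hα : ∀ b, DependsOn (F · b) (Set.Iio m)) (hβ : ∀ a, DependsOn (F a) (Set.Iio n)) :
    Measurable fun ω : (ℕ → α) × (ℕ → β) => F ω.1 ω.2 := by
  let T : (ℕ → α) × (ℕ → β) → (Finset.range m → α) × (Finset.range n → β) :=
    Prod.map (fun a i => a i) (fun b i => b i)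
  have hT : Measurable T := (measurable_prefix m).prodMap (measurable_prefix n)
  have hfactors : Function.FactorsThrough (fun ω : (ℕ → α) × (ℕ → β) => F ω.1 ω.2) T := by
    intro ω ω' h
    obtain ⟨h₁, h₂⟩ := Prod.ext_iff.1 h
    calc F ω.1 ω.2 = F ω'.1 ω.2 := hα _ fun i hi => congrFun h₁ ⟨i, Finset.mem_range.2 hi⟩
      _ = F ω'.1 ω'.2 := hβ _ fun i hi => congrFun h₂ ⟨i, Finset.mem_range.2 hi⟩
  obtain ⟨g, hg⟩ := (Function.factorsThrough_iff _).1 hfactors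
  rw [hg]
  exact (Measurable.of_discrete (f := g)).comp hT

variable {p : Measure α} [IsProbabilityMeasure p]

lemma indepFun_eval_of_dependsOn [MeasurableSpace γ] [Nonempty γ] {f : (ℕ → α) → γ}
    (hf : DependsOn f (Set.Iio n)) :
    IndepFun (fun ω : ℕ → α => ω n) f (Measure.infinitePi fun _ => p) := by
  obtain ⟨g, rfl⟩ := exists_eq_comp_restrict_of_dependsOn hf
  have hindep := (iIndepFun_infinitePi (P := fun _ : ℕ => p) (X := fun _ x => x)
    fun _ => measurable_id).indepFun_finset {n} (Finset.range n) (by simp)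
    fun i => measurable_pi_apply i
  exact hindep.comp (φ := fun x : ({n} : Finset ℕ) → α => x ⟨n, Finset.mem_singleton_self n⟩)
    (measurable_pi_apply _) (Measurable.of_discrete (f := g))

lemma integral_eval_mul_of_dependsOn (h : α → ℝ) {f : (ℕ → α) → ℝ}
    (hf : DependsOn f (Set.Iio n)) :
    ∫ ω, h (ω n) * f ω ∂(Measure.infinitePi fun _ => p) =
      (∫ x, h x ∂p) * ∫ ω, f ω ∂(Measure.infinitePi fun _ => p) := by
  have hh : Measurable h := Measurable.of_discrete
  have heval := measurePreserving_eval_infinitePi (fun _ : ℕ => p) n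
  rw [← heval.map_eq,
    integral_map (measurable_pi_apply n).aemeasurable hh.aestronglyMeasurable, heval.map_eq]
  exact ((indepFun_eval_of_dependsOn hf).comp hh measurable_id).integral_fun_mul_eq_mul_integral
    (hh.comp (measurable_pi_apply n)).aestronglyMeasurable
    (measurable_of_dependsOn hf).aestronglyMeasurable

lemma ae_not_of_ae_imp_eval_eq {v : α} (hv : p {v} ≠ 1) {Q : (ℕ → α) → Prop}
    (hQ : DependsOn Q (Set.Iio n))
    (h : ∀ᵐ ω ∂(Measure.infinitePi fun _ => p), Q ω → ω n = v) :
    ∀ᵐ ω ∂(Measure.infinitePi fun _ => p), ¬ Q ω := by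
  have hindep := (indepFun_eval_of_dependsOn (p := p) hQ).measure_inter_preimage_eq_mul
    {v}ᶜ {True} (measurableSet_singleton v).compl (measurableSet_singleton True)
  have heval : (Measure.infinitePi fun _ : ℕ => p) ((fun ω => ω n) ⁻¹' {v}ᶜ) = p {v}ᶜ :=
    (measurePreserving_eval_infinitePi _ n).measure_preimage
      (measurableSet_singleton v).compl.nullMeasurableSet
  have hnull : (Measure.infinitePi fun _ : ℕ => p)
      ((fun ω => ω n) ⁻¹' {v}ᶜ ∩ Q ⁻¹' {True}) = 0 := by
    rw [measure_eq_zero_iff_ae_notMem]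
    filter_upwards [h] with ω himp hω using hω.1 (himp (of_eq_true hω.2))
  rw [hnull, heval, eq_comm, mul_eq_zero, prob_compl_eq_zero_iff (measurableSet_singleton v),
    or_iff_right hv, measure_eq_zero_iff_ae_notMem] at hindep
  filter_upwards [hindep] with ω hω hQω using hω (eq_true hQω)

lemma ae_prod_not_of_ae_imp_eval_eq [Countable β] [MeasurableSpace β] [MeasurableSingletonClass β]
    {ν : Measure (ℕ → β)} [SFinite ν] {v : α} (hv : p {v} ≠ 1)
    {Q : (ℕ → α) → (ℕ → β) → Prop} (hα : ∀ b, DependsOn (Q · b) (Set.Iio m))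
    (hβ : ∀ a, DependsOn (Q a) (Set.Iio n))
    (h : ∀ᵐ ω ∂((Measure.infinitePi fun _ => p).prod ν), Q ω.1 ω.2 → ω.1 m = v) :
    ∀ᵐ ω ∂((Measure.infinitePi fun _ => p).prod ν), ¬ Q ω.1 ω.2 := by
  have hQ : MeasurableSet {ω : (ℕ → α) × (ℕ → β) | Q ω.1 ω.2} :=
    measurableSet_setOfPred.2 (measurable_of_dependsOn_of_dependsOn hα hβ)
  have heval : MeasurableSet {ω : (ℕ → α) × (ℕ → β) | ω.1 m = v} :=
    measurableSet_eq_fun ((measurable_pi_apply m).comp measurable_fst) measurable_const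
  rw [Measure.ae_prod_iff_ae_ae (hQ.imp heval), Measure.ae_ae_comm (hQ.imp heval)] at h
  have hQnot : MeasurableSet {ω : (ℕ → α) × (ℕ → β) | ¬ Q ω.1 ω.2} := hQ.compl
  rw [Measure.ae_prod_iff_ae_ae hQnot, Measure.ae_ae_comm hQnot]
  filter_upwards [h] with b hb using ae_not_of_ae_imp_eval_eq hv (hα b) hb

end Prefix

/-- The law of the erasure pattern: independent uses, each erased (`true`) with probability `ε`. -/
noncomputable abbrev erasureLaw (ε : unitInterval) : Measure (ℕ → Bool) :=
  Measure.infinitePi fun _ => bernoulliMeasure true false ε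

lemma integral_ite_erasure (ε : unitInterval) {n : ℕ} {f g : (ℕ → Bool) → ℝ}
    (hf : DependsOn f (Set.Iio n)) (hg : DependsOn g (Set.Iio n)) :
    ∫ b, (if b n then f b else g b) ∂(erasureLaw ε) =
      ε * ∫ b, f b ∂(erasureLaw ε) + (1 - ε) * ∫ b, g b ∂(erasureLaw ε) := by
  have hint : ∀ (h : Bool → ℝ) {k : (ℕ → Bool) → ℝ}, DependsOn k (Set.Iio n) →
      Integrable (fun b => h (b n) * k b) (erasureLaw ε) := fun h k hk =>
    memLp_one_iff_integrable.1 <| memLp_of_dependsOn (n := n + 1) fun b b' hbb' => by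
      simp only [hbb' n n.lt_succ_self, hk fun i hi => hbb' i (hi.trans n.lt_succ_self)]
  calc ∫ b, (if b n then f b else g b) ∂(erasureLaw ε)
      = ∫ b, (cond (b n) 1 0 * f b + cond (b n) 0 1 * g b) ∂(erasureLaw ε) := by
        refine integral_congr_ae (Eventually.of_forall fun b => ?_)
        cases hb : b n <;> simp [hb]
    _ = (ε : ℝ) * ∫ b, f b ∂(erasureLaw ε) + (1 - ε) * ∫ b, g b ∂(erasureLaw ε) := by
        rw [integral_add (hint (cond · 1 0) hf) (hint (cond · 0 1) hg),
          integral_eval_mul_of_dependsOn (cond · 1 0) hf,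
          integral_eval_mul_of_dependsOn (cond · 0 1) hg,
          integral_bernoulliMeasure, integral_bernoulliMeasure]
        simp

section ResetProcess

variable (a : ℝ) (ψ : ℕ → ℝ) (ε : unitInterval)

/-- The process that grows by `a` at every erasure (`b n = true`) and is reset to the prescribed
value `ψ (n + 1)` otherwise: the age of the freshest delivered symbol, sampled at channel uses. -/
def resetProcess (b : ℕ → Bool) : ℕ → ℝ
  | 0 => ψ 0
  | n + 1 => if b n then resetProcess b n + a else ψ (n + 1)

/-- The martingale difference of the reset process: its value at `n + 1` minus the conditional
expectation of that value given the first `n` erasures. -/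
def resetInnovation (b : ℕ → Bool) (n : ℕ) : ℝ :=
  resetProcess a ψ b (n + 1) - (ε * (resetProcess a ψ b n + a) + (1 - ε) * ψ (n + 1))

lemma resetInnovation_eq_ite (b : ℕ → Bool) (n : ℕ) :
    resetInnovation a ψ ε b n =
      if b n then (1 - ε) * (resetProcess a ψ b n + a - ψ (n + 1))
      else -ε * (resetProcess a ψ b n + a - ψ (n + 1)) := by
  rw [resetInnovation, resetProcess]
  split_ifs <;> ring

lemma dependsOn_resetProcess (n : ℕ) : DependsOn (fun b => resetProcess a ψ b n) (Set.Iio n) := by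
  induction n with
  | zero => exact fun _ _ _ => rfl
  | succ n ih =>
    intro b b' h
    have hn : resetProcess a ψ b n = resetProcess a ψ b' n :=
      ih fun i hi => h i (hi.trans n.lt_succ_self)
    simp only [resetProcess, h n n.lt_succ_self, hn]

lemma dependsOn_resetInnovation (n : ℕ) :
    DependsOn (fun b => resetInnovation a ψ ε b n) (Set.Iio (n + 1)) := by
  intro b b' h
  have hn : resetProcess a ψ b n = resetProcess a ψ b' n :=
    dependsOn_resetProcess a ψ n fun i hi => h i (hi.trans n.lt_succ_self)
  have hsucc : resetProcess a ψ b (n + 1) = resetProcess a ψ b' (n + 1) :=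
    dependsOn_resetProcess a ψ (n + 1) h
  simp only [resetInnovation, hn, hsucc]

lemma integral_resetInnovation_mul_eq_zero {m n : ℕ} (hmn : m < n) :
    ∫ b, resetInnovation a ψ ε b m * resetInnovation a ψ ε b n ∂(erasureLaw ε) = 0 := by
  let h : (ℕ → Bool) → ℝ := fun b =>
    resetInnovation a ψ ε b m * (resetProcess a ψ b n + a - ψ (n + 1))
  have hdep : ∀ c : ℝ, DependsOn (fun b => c * h b) (Set.Iio n) := fun c b b' hbb' => by
    have hm : resetInnovation a ψ ε b m = resetInnovation a ψ ε b' m :=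
      dependsOn_resetInnovation a ψ ε m fun i hi => hbb' i (Set.mem_Iio.2 (lt_of_lt_of_le hi hmn))
    have hn : resetProcess a ψ b n = resetProcess a ψ b' n := dependsOn_resetProcess a ψ n hbb'
    simp only [h, hm, hn]
  calc ∫ b, resetInnovation a ψ ε b m * resetInnovation a ψ ε b n ∂(erasureLaw ε)
      = ∫ b, (if b n then (1 - ε) * h b else -ε * h b) ∂(erasureLaw ε) := by
        refine integral_congr_ae (Eventually.of_forall fun b => ?_)
        simp only [resetInnovation_eq_ite a ψ ε b n, h]
        split_ifs <;> ring
    _ = 0 := by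
        rw [integral_ite_erasure ε (hdep _) (hdep _), integral_const_mul, integral_const_mul]
        ring

variable {a ψ ε} {B : ℝ}

lemma mul_add_sq_le {e : ℝ} (he₀ : 0 ≤ e) (he₁ : e < 1) (x a : ℝ) :
    e * (x + a) ^ 2 ≤ (1 + e) / 2 * x ^ 2 + 2 * a ^ 2 / (1 - e) := by
  have he : 0 < 1 - e := sub_pos.2 he₁
  have hsquares : (1 + e) / 2 * x ^ 2 + 2 * a ^ 2 / (1 - e) - e * (x + a) ^ 2 =
      (1 - e) / 2 * (x - 2 * e * a / (1 - e)) ^ 2 + (2 + e) * a ^ 2 := by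
    field_simp
    ring
  have : 0 ≤ (1 - e) / 2 * (x - 2 * e * a / (1 - e)) ^ 2 + (2 + e) * a ^ 2 := by positivity
  linarith

lemma memLp_resetProcess (n : ℕ) :
    MemLp (fun b => resetProcess a ψ b n) 2 (erasureLaw ε) :=
  memLp_of_dependsOn (dependsOn_resetProcess a ψ n)

lemma memLp_resetProcess_add_const (c : ℝ) (n : ℕ) :
    MemLp (fun b => resetProcess a ψ b n + c) 2 (erasureLaw ε) :=
  (memLp_resetProcess n).add (memLp_const c)

lemma integral_resetProcess_sq_succ (n : ℕ) :
    ∫ b, resetProcess a ψ b (n + 1) ^ 2 ∂(erasureLaw ε) =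
      ε * ∫ b, (resetProcess a ψ b n + a) ^ 2 ∂(erasureLaw ε) + (1 - ε) * ψ (n + 1) ^ 2 := by
  have hdep : DependsOn (fun b => (resetProcess a ψ b n + a) ^ 2) (Set.Iio n) := fun _ _ h =>
    congrArg (fun x => (x + a) ^ 2) (dependsOn_resetProcess a ψ n h)
  have hconst : DependsOn (fun _ : ℕ → Bool => ψ (n + 1) ^ 2) (Set.Iio n) := fun _ _ _ => rfl
  have h := integral_ite_erasure ε hdep hconst
  rw [integral_const, probReal_univ, one_smul] at h
  simp only [resetProcess, ite_pow, h]

lemma integral_resetProcess_sq_succ_le (hε : (ε : ℝ) < 1) (n : ℕ) :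
    ∫ b, resetProcess a ψ b (n + 1) ^ 2 ∂(erasureLaw ε) ≤
      (1 + ε) / 2 * ∫ b, resetProcess a ψ b n ^ 2 ∂(erasureLaw ε) +
        (2 * a ^ 2 / (1 - ε) + ψ (n + 1) ^ 2) := by
  have hint : Integrable (fun b => (1 + ε) / 2 * resetProcess a ψ b n ^ 2) (erasureLaw ε) :=
    (memLp_resetProcess n).integrable_sq.const_mul _
  calc ∫ b, resetProcess a ψ b (n + 1) ^ 2 ∂(erasureLaw ε)
      = ∫ b, ε * (resetProcess a ψ b n + a) ^ 2 ∂(erasureLaw ε) + (1 - ε) * ψ (n + 1) ^ 2 := by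
        rw [integral_resetProcess_sq_succ, integral_const_mul]
    _ ≤ ∫ b, ((1 + ε) / 2 * resetProcess a ψ b n ^ 2 + 2 * a ^ 2 / (1 - ε)) ∂(erasureLaw ε) +
          ψ (n + 1) ^ 2 := by
        refine add_le_add (integral_mono ?_ (hint.add (integrable_const _)) fun b =>
          mul_add_sq_le ε.2.1 hε _ _) (mul_le_of_le_one_left (sq_nonneg _) ?_)
        · exact (memLp_resetProcess_add_const a n).integrable_sq.const_mul _
        · exact sub_le_self 1 ε.2.1
    _ = _ := by
        rw [integral_add hint (integrable_const _), integral_const_mul, integral_const,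
          probReal_univ, one_smul, add_assoc]

lemma integral_resetProcess_sq_le (hε : (ε : ℝ) < 1) (hψ : ∀ n, |ψ n| ≤ B) (n : ℕ) :
    ∫ b, resetProcess a ψ b n ^ 2 ∂(erasureLaw ε) ≤
      2 * (2 * a ^ 2 / (1 - ε) + B ^ 2) / (1 - ε) := by
  have hε' : (0 : ℝ) < 1 - ε := sub_pos.2 hε
  have hψsq : ∀ n, ψ n ^ 2 ≤ B ^ 2 := fun n => sq_le_sq' (abs_le.1 (hψ n)).1 (abs_le.1 (hψ n)).2
  set K := 2 * a ^ 2 / (1 - (ε : ℝ))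
  have hK : 0 ≤ K := by positivity
  induction n with
  | zero =>
    simp only [resetProcess, integral_const, probReal_univ, one_smul]
    rw [le_div_iff₀ hε']
    nlinarith [hψsq 0, sq_nonneg B, mul_nonneg ε.2.1 (sq_nonneg (ψ 0))]
  | succ n ih =>
    set M := 2 * (K + B ^ 2) / (1 - (ε : ℝ)) with hM
    calc ∫ b, resetProcess a ψ b (n + 1) ^ 2 ∂(erasureLaw ε)
        ≤ (1 + ε) / 2 * ∫ b, resetProcess a ψ b n ^ 2 ∂(erasureLaw ε) + (K + ψ (n + 1) ^ 2) :=
          integral_resetProcess_sq_succ_le hε n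
      _ ≤ (1 + ε) / 2 * M + (K + B ^ 2) := by
          refine add_le_add (mul_le_mul_of_nonneg_left ih ?_) (add_le_add_right (hψsq _) K)
          linarith [ε.2.1]
      _ = M := by
          rw [hM]
          field_simp
          ring

lemma integral_resetInnovation_sq (n : ℕ) :
    ∫ b, resetInnovation a ψ ε b n ^ 2 ∂(erasureLaw ε) =
      ε * (1 - ε) * ∫ b, (resetProcess a ψ b n + (a - ψ (n + 1))) ^ 2 ∂(erasureLaw ε) := by
  let h : (ℕ → Bool) → ℝ := fun b => (resetProcess a ψ b n + (a - ψ (n + 1))) ^ 2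
  have hdep : ∀ c : ℝ, DependsOn (fun b => c * h b) (Set.Iio n) := fun c _ _ hbb' =>
    congrArg (fun x => c * (x + (a - ψ (n + 1))) ^ 2) (dependsOn_resetProcess a ψ n hbb')
  calc ∫ b, resetInnovation a ψ ε b n ^ 2 ∂(erasureLaw ε)
      = ∫ b, (if b n then (1 - ε) ^ 2 * h b else ε ^ 2 * h b) ∂(erasureLaw ε) := by
        refine integral_congr_ae (Eventually.of_forall fun b => ?_)
        simp only [resetInnovation_eq_ite, h]
        split_ifs <;> ring
    _ = ε * (1 - ε) * ∫ b, h b ∂(erasureLaw ε) := by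
        rw [integral_ite_erasure ε (hdep _) (hdep _), integral_const_mul, integral_const_mul]
        ring

lemma integral_resetInnovation_sq_le (hψ : ∀ n, |ψ n| ≤ B) {C : ℝ} {n : ℕ}
    (hC : ∫ b, resetProcess a ψ b n ^ 2 ∂(erasureLaw ε) ≤ C) :
    ∫ b, resetInnovation a ψ ε b n ^ 2 ∂(erasureLaw ε) ≤ 2 * (C + (|a| + B) ^ 2) := by
  have hint : Integrable (fun b => resetProcess a ψ b n ^ 2) (erasureLaw ε) :=
    (memLp_resetProcess n).integrable_sq
  have hjump : (a - ψ (n + 1)) ^ 2 ≤ (|a| + B) ^ 2 := by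
    rw [← sq_abs]
    gcongr
    exact (abs_sub _ _).trans (by gcongr; exact hψ _)
  calc ∫ b, resetInnovation a ψ ε b n ^ 2 ∂(erasureLaw ε)
      = ε * (1 - ε) * ∫ b, (resetProcess a ψ b n + (a - ψ (n + 1))) ^ 2 ∂(erasureLaw ε) :=
        integral_resetInnovation_sq n
    _ ≤ ∫ b, (resetProcess a ψ b n + (a - ψ (n + 1))) ^ 2 ∂(erasureLaw ε) :=
        mul_le_of_le_one_left (integral_nonneg fun _ => sq_nonneg _)
          (mul_le_one₀ ε.2.2 (sub_nonneg.2 ε.2.2) (sub_le_self 1 ε.2.1))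
    _ ≤ ∫ b, 2 * (resetProcess a ψ b n ^ 2 + (a - ψ (n + 1)) ^ 2) ∂(erasureLaw ε) :=
        integral_mono (memLp_resetProcess_add_const _ n).integrable_sq
          ((hint.add (integrable_const _)).const_mul 2) fun _ => add_sq_le
    _ = 2 * (∫ b, resetProcess a ψ b n ^ 2 ∂(erasureLaw ε) + (a - ψ (n + 1)) ^ 2) := by
        rw [integral_const_mul, integral_add hint (integrable_const _), integral_const,
          probReal_univ, one_smul]
    _ ≤ 2 * (C + (|a| + B) ^ 2) := by gcongr

lemma ae_tendsto_resetProcess_div (hε : (ε : ℝ) < 1) (hψ : ∀ n, |ψ n| ≤ B) :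
    ∀ᵐ b ∂(erasureLaw ε), Tendsto (fun N : ℕ => resetProcess a ψ b N / N) atTop (𝓝 0) := by
  refine ae_tendsto_zero_of_integral_sq_le (C := 2 * (2 * a ^ 2 / (1 - ε) + B ^ 2) / (1 - ε))
    (fun n => memLp_div_const (memLp_resetProcess n) _) fun n => ?_
  rw [integral_div_sq]
  gcongr
  exact integral_resetProcess_sq_le hε hψ n

lemma ae_hasCesaroMean_resetInnovation (hε : (ε : ℝ) < 1) (hψ : ∀ n, |ψ n| ≤ B) :
    ∀ᵐ b ∂(erasureLaw ε), HasCesaroMean (resetInnovation a ψ ε b) 0 := by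
  refine ae_hasCesaroMean_zero_of_orthogonal (Y := fun n b => resetInnovation a ψ ε b n)
    (fun n => memLp_of_dependsOn (dependsOn_resetInnovation a ψ ε n)) (fun m n hmn => ?_)
    fun n => integral_resetInnovation_sq_le hψ (integral_resetProcess_sq_le hε hψ n)
  rcases hmn.lt_or_gt with h | h
  · exact integral_resetInnovation_mul_eq_zero a ψ ε h
  · simpa only [mul_comm] using integral_resetInnovation_mul_eq_zero a ψ ε h

theorem ae_hasCesaroMean_resetProcess (hε : (ε : ℝ) < 1) (hψ : ∀ n, |ψ n| ≤ B) {L : ℝ}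
    (hL : HasCesaroMean ψ L) :
    ∀ᵐ b ∂(erasureLaw ε), HasCesaroMean (resetProcess a ψ b) (a * ε / (1 - ε) + L) := by
  have hε' : (1 - ε : ℝ) ≠ 0 := (sub_pos.2 hε).ne'
  have hψlim : Tendsto (fun N : ℕ => ψ N / N) atTop (𝓝 0) :=
    squeeze_zero_norm (fun N => by
      rw [norm_div, Real.norm_eq_abs, Real.norm_natCast]
      gcongr
      exact hψ N) (tendsto_const_div_atTop_nhds_zero_nat B)
  filter_upwards [ae_tendsto_resetProcess_div hε hψ, ae_hasCesaroMean_resetInnovation hε hψ]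
    with b hX hD
  have hmean := (((hasCesaroMean_const (ε * a)).add
    ((hL.add (hasCesaroMean_succ_sub hψlim)).const_mul (1 - (ε : ℝ)))).add
    (hD.sub (hasCesaroMean_succ_sub hX))).const_mul (1 - (ε : ℝ))⁻¹
  convert hmean using 1
  · funext n
    rw [resetInnovation]
    field_simp
    ring
  · field_simp
    ring

end ResetProcess

section TimeAverage

variable {mu L : ℝ}

/-- The age at time `t` when channel uses take place at rate `mu` and the freshest symbol decoded
during the first `n` of them was generated at time `u n`. -/
noncomputable def stepAge (mu : ℝ) (u : ℕ → ℝ) (t : ℝ) : ℝ :=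
  t - u ⌊t * mu⌋₊

variable {u v : ℕ → ℝ}

lemma intervalIntegrable_stepAge (hmu : 0 ≤ mu) (hu : Monotone u) (x y : ℝ) :
    IntervalIntegrable (stepAge mu u) volume x y := by
  have hstep : Monotone fun t : ℝ => u ⌊t * mu⌋₊ := fun s t hst =>
    hu (Nat.floor_mono (mul_le_mul_of_nonneg_right hst hmu))
  exact (continuous_id.intervalIntegrable x y).sub hstep.intervalIntegrable

lemma stepAge_nonneg (hmu : 0 < mu) (hu : ∀ n : ℕ, u n ≤ n / mu) {t : ℝ} (ht : 0 ≤ t) :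
    0 ≤ stepAge mu u t := by
  have hfloor : (⌊t * mu⌋₊ : ℝ) / mu ≤ t :=
    (div_le_iff₀ hmu).2 (Nat.floor_le (mul_nonneg ht hmu.le))
  exact sub_nonneg.2 ((hu _).trans hfloor)

lemma timeAverage_stepAge_anti (hmu : 0 ≤ mu) (hu : Monotone u) (hv : Monotone v)
    (huv : ∀ n, u n ≤ v n) {τ : ℝ} (hτ : 0 ≤ τ) :
    1 / τ * ∫ t in (0 : ℝ)..τ, stepAge mu v t ≤ 1 / τ * ∫ t in (0 : ℝ)..τ, stepAge mu u t := by
  gcongr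
  exact intervalIntegral.integral_mono_on hτ (intervalIntegrable_stepAge hmu hv _ _)
    (intervalIntegrable_stepAge hmu hu _ _) fun t _ => sub_le_sub_left (huv _) t

lemma integral_stepAge_succ (hmu : 0 < mu) (u : ℕ → ℝ) (n : ℕ) :
    ∫ t in ((n : ℝ) / mu)..(((n + 1 : ℕ) : ℝ) / mu), stepAge mu u t =
      (n / mu - u n) / mu + 1 / (2 * mu ^ 2) := by
  have hle : (n : ℝ) / mu ≤ ((n + 1 : ℕ) : ℝ) / mu := by
    gcongr
    exact n.le_succ
  have hconst : Set.EqOn (stepAge mu u) (fun t => t - u n)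
      (Set.Ioo ((n : ℝ) / mu) (((n + 1 : ℕ) : ℝ) / mu)) := fun t ht => by
    have hn : (n : ℝ) ≤ t * mu := ((div_lt_iff₀ hmu).1 ht.1).le
    have hn' : t * mu < n + 1 := by exact_mod_cast (lt_div_iff₀ hmu).1 ht.2
    rw [stepAge, (Nat.floor_eq_iff (n.cast_nonneg.trans hn)).2 ⟨hn, hn'⟩]
  rw [intervalIntegral.integral_congr_Ioo_of_le hle hconst,
    intervalIntegral.integral_sub intervalIntegral.intervalIntegrable_id
      intervalIntegrable_const, integral_id, intervalIntegral.integral_const, smul_eq_mul]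
  push_cast
  field_simp
  ring

lemma integral_stepAge (hmu : 0 < mu) (hu : Monotone u) (N : ℕ) :
    ∫ t in (0 : ℝ)..(N / mu), stepAge mu u t =
      (∑ n ∈ Finset.range N, (n / mu - u n)) / mu + N * (1 / (2 * mu ^ 2)) := by
  have hsum := intervalIntegral.sum_integral_adjacent_intervals (μ := volume)
    (f := stepAge mu u) (a := fun n : ℕ => (n : ℝ) / mu) (n := N)
    fun _ _ => intervalIntegrable_stepAge hmu.le hu _ _
  rw [Nat.cast_zero, zero_div] at hsum
  rw [← hsum, Finset.sum_congr rfl fun n _ => integral_stepAge_succ hmu u n,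
    Finset.sum_add_distrib, Finset.sum_div, Finset.sum_const, Finset.card_range, nsmul_eq_mul]

lemma tendsto_grid_comp_div (hmu : mu ≠ 0) {I : ℝ → ℝ}
    (hI : Tendsto (fun N : ℕ => I (N / mu) / N) atTop (𝓝 (L / mu))) {k : ℝ → ℕ}
    (hk : Tendsto k atTop atTop) (hkdiv : Tendsto (fun τ => (k τ : ℝ) / τ) atTop (𝓝 mu)) :
    Tendsto (fun τ => I (k τ / mu) / τ) atTop (𝓝 L) := by
  have h := (hI.comp hk).mul hkdiv
  rw [div_mul_cancel₀ L hmu] at h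
  refine h.congr' ?_
  filter_upwards [hk.eventually_ne_atTop 0] with τ hτ
  exact div_mul_div_cancel₀ (Nat.cast_ne_zero.2 hτ)

lemma tendsto_div_of_tendsto_grid (hmu : 0 < mu) {I : ℝ → ℝ} (hmono : MonotoneOn I (Set.Ici 0))
    (hI : Tendsto (fun N : ℕ => I (N / mu) / N) atTop (𝓝 (L / mu))) :
    Tendsto (fun τ => I τ / τ) atTop (𝓝 L) := by
  have hmul : Tendsto (fun τ : ℝ => mu * τ) atTop atTop := tendsto_id.const_mul_atTop hmu
  refine tendsto_of_tendsto_of_tendsto_of_le_of_le'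
    (tendsto_grid_comp_div hmu.ne' hI (tendsto_nat_floor_atTop.comp hmul)
      (tendsto_nat_floor_mul_div_atTop hmu.le))
    (tendsto_grid_comp_div hmu.ne' hI (tendsto_nat_ceil_atTop.comp hmul)
      (tendsto_nat_ceil_mul_div_atTop hmu.le)) ?_ ?_ <;>
    filter_upwards [eventually_gt_atTop 0] with τ hτ
  · have hfloor : (⌊mu * τ⌋₊ : ℝ) / mu ≤ τ :=
      (div_le_iff₀' hmu).2 (Nat.floor_le (mul_pos hmu hτ).le)
    exact div_le_div_of_nonneg_right
      (hmono (Set.mem_Ici.2 (by positivity)) hτ.le hfloor) hτ.le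
  · have hceil : τ ≤ (⌈mu * τ⌉₊ : ℝ) / mu := (le_div_iff₀' hmu).2 (Nat.le_ceil _)
    exact div_le_div_of_nonneg_right (hmono hτ.le (hτ.le.trans hceil) hceil) hτ.le

lemma monotoneOn_intervalIntegral_of_nonneg {f : ℝ → ℝ}
    (hint : ∀ x y, IntervalIntegrable f volume x y) (hf : ∀ t, 0 ≤ t → 0 ≤ f t) :
    MonotoneOn (fun τ => ∫ t in (0 : ℝ)..τ, f t) (Set.Ici 0) := fun x hx y _ hxy => by
  rw [← sub_nonneg, intervalIntegral.integral_interval_sub_left (hint 0 y) (hint 0 x)]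
  exact intervalIntegral.integral_nonneg hxy fun t ht => hf t (le_trans hx ht.1)

theorem tendsto_timeAverage_stepAge (hmu : 0 < mu) (hu : Monotone u)
    (hu' : ∀ n : ℕ, u n ≤ n / mu) (hL : HasCesaroMean (fun n : ℕ => n / mu - u n) L) :
    Tendsto (fun τ : ℝ => 1 / τ * ∫ t in (0 : ℝ)..τ, stepAge mu u t) atTop
      (𝓝 (L + 1 / (2 * mu))) := by
  simp only [one_div_mul_eq_div]
  refine tendsto_div_of_tendsto_grid hmu (monotoneOn_intervalIntegral_of_nonneg
    (intervalIntegrable_stepAge hmu.le hu) fun t ht => stepAge_nonneg hmu hu' ht) ?_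
  have hgrid : L / mu + 1 / (2 * mu ^ 2) = (L + 1 / (2 * mu)) / mu := by
    field_simp
  rw [← hgrid]
  refine ((Tendsto.div_const hL mu).add_const (1 / (2 * mu ^ 2))).congr' ?_
  filter_upwards [eventually_ne_atTop 0] with N hN
  have hN' : (N : ℝ) ≠ 0 := Nat.cast_ne_zero.2 hN
  rw [integral_stepAge hmu hu, add_div, mul_div_cancel_left₀ _ hN', div_right_comm]

end TimeAverage

lemma numGenerated_mono {ρ : ℝ} (hρ : 0 ≤ ρ) : Monotone (numGenerated ρ) := fun _ _ hij =>
  Nat.floor_mono (mul_le_mul_of_nonneg_right (Nat.cast_le.2 hij) hρ)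

/-- The last of the channel uses `1, …, n` that is not erased, and `0` if there is none. -/
def lastReceived (b : ℕ → Bool) : ℕ → ℕ
  | 0 => 0
  | n + 1 => if b n then lastReceived b n else n + 1

section LastReceived

variable (b : ℕ → Bool)

lemma lastReceived_le (n : ℕ) : lastReceived b n ≤ n := by
  induction n with
  | zero => rfl
  | succ n ih =>
    rw [lastReceived]
    split_ifs
    · exact ih.trans n.le_succ
    · rfl

lemma lastReceived_mono : Monotone (lastReceived b) :=
  monotone_nat_of_le_succ fun n => by
    rw [lastReceived]
    split_ifs
    · rfl
    · exact (lastReceived_le b n).trans n.le_succ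

variable {b}

lemma succ_le_lastReceived {k n : ℕ} (hk : k < n) (hb : ¬ b k) : k + 1 ≤ lastReceived b n := by
  have hlast : lastReceived b (k + 1) = k + 1 := if_neg hb
  exact hlast.ge.trans (lastReceived_mono b hk)

lemma dependsOn_lastReceived (n : ℕ) : DependsOn (fun b => lastReceived b n) (Set.Iio n) := by
  induction n with
  | zero => exact fun _ _ _ => rfl
  | succ n ih =>
    intro b b' h
    have hn : lastReceived b n = lastReceived b' n := ih fun i hi => h i (hi.trans n.lt_succ_self)
    simp only [lastReceived, h n n.lt_succ_self, hn]

end LastReceived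

section DeliverableTime

/-- The time elapsed at the `n`-th channel use since the generation of the freshest symbol. -/
noncomputable def generationDelay (lam mu : ℝ) (n : ℕ) : ℝ :=
  n / mu - numGenerated (lam / mu) n / lam

/-- The generation time of the freshest symbol that the first `n` channel outputs can depend on
when the erasure pattern is `b`. -/
noncomputable def deliverableTime (lam mu : ℝ) (b : ℕ → Bool) (n : ℕ) : ℝ :=
  numGenerated (lam / mu) (lastReceived b n) / lam

variable {lam mu : ℝ}

lemma generationDelay_eq_fract (hlam : 0 < lam) (hmu : 0 ≤ mu) (n : ℕ) :
    generationDelay lam mu n = lam⁻¹ * Int.fract (n * (lam / mu)) := by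
  rw [generationDelay, numGenerated, natCast_floor_eq_intCast_floor (by positivity),
    ← Int.self_sub_fract]
  field_simp
  ring

lemma sub_deliverableTime (b : ℕ → Bool) (n : ℕ) :
    n / mu - deliverableTime lam mu b n = resetProcess (1 / mu) (generationDelay lam mu) b n := by
  induction n with
  | zero => rfl
  | succ n ih =>
    rw [resetProcess, ← ih, deliverableTime, deliverableTime, lastReceived]
    split_ifs
    · push_cast
      ring
    · rfl

lemma deliverableTime_mono (hlam : 0 ≤ lam) (hmu : 0 ≤ mu) (b : ℕ → Bool) :
    Monotone (deliverableTime lam mu b) := fun _ _ h =>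
  div_le_div_of_nonneg_right (Nat.cast_le.2
    (numGenerated_mono (div_nonneg hlam hmu) (lastReceived_mono b h))) hlam

lemma deliverableTime_le (hlam : 0 < lam) (hmu : 0 ≤ mu) (b : ℕ → Bool) (n : ℕ) :
    deliverableTime lam mu b n ≤ n / mu := by
  have hdelay : 0 ≤ generationDelay lam mu (lastReceived b n) := by
    rw [generationDelay_eq_fract hlam hmu]
    exact mul_nonneg (inv_nonneg.2 hlam.le) (Int.fract_nonneg _)
  calc deliverableTime lam mu b n ≤ lastReceived b n / mu := sub_nonneg.1 hdelay
    _ ≤ n / mu := div_le_div_of_nonneg_right (Nat.cast_le.2 (lastReceived_le b n)) hmu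

theorem ae_tendsto_timeAverage_deliverableTime (hlam : 0 < lam) (hmu : 0 < mu)
    {ε : unitInterval} (hε : (ε : ℝ) < 1) {c : ℝ}
    (hc : HasCesaroMean (fun n => Int.fract (n * (lam / mu))) c) :
    ∀ᵐ b ∂(erasureLaw ε), Tendsto
      (fun τ : ℝ => 1 / τ * ∫ t in (0 : ℝ)..τ, stepAge mu (deliverableTime lam mu b) t) atTop
      (𝓝 (c / lam + (1 + ε) / (2 * mu * (1 - ε)))) := by
  have hε' : (0 : ℝ) < 1 - ε := sub_pos.2 hε
  have hdelay : generationDelay lam mu = fun n : ℕ => lam⁻¹ * Int.fract (n * (lam / mu)) :=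
    funext (generationDelay_eq_fract hlam hmu.le)
  have hbound : ∀ n, |generationDelay lam mu n| ≤ lam⁻¹ := fun n => by
    rw [hdelay, abs_of_nonneg (mul_nonneg (inv_nonneg.2 hlam.le) (Int.fract_nonneg _))]
    exact mul_le_of_le_one_right (inv_nonneg.2 hlam.le) (Int.fract_lt_one _).le
  have hmean : HasCesaroMean (generationDelay lam mu) (lam⁻¹ * c) := hdelay ▸ hc.const_mul _
  filter_upwards [ae_hasCesaroMean_resetProcess (a := 1 / mu) hε hbound hmean] with b hb
  have hsampled : HasCesaroMean (fun n : ℕ => n / mu - deliverableTime lam mu b n)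
      (1 / mu * ε / (1 - ε) + lam⁻¹ * c) := by
    simpa only [sub_deliverableTime] using hb
  convert tendsto_timeAverage_stepAge hmu (deliverableTime_mono hlam.le hmu.le b)
    (deliverableTime_le hlam hmu.le b) hsampled using 2
  field_simp
  ring

end DeliverableTime

namespace CodingScheme

variable {U V : Type*} {ρ lam mu : ℝ}

section Causality

variable (C : CodingScheme U V ρ)

lemma freshestIndex_mono (ω : Sample U) : Monotone (C.freshestIndex ω) := fun _ _ h =>
  Finset.sup_mono (Finset.Icc_subset_Icc_right h)

lemma dependsOn_output_erasures (u : ℕ → U) (i : ℕ) :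
    DependsOn (fun b => C.output (u, b) i) (Set.Iio i) := fun b b' h => by
  have hreceived : C.received (u, b) i = C.received (u, b') i :=
    funext fun k => by simp only [received, h k k.2]
  exact congrArg (C.dec i) hreceived

lemma dependsOn_output_source (hρ : 0 ≤ ρ) (b : ℕ → Bool) (i : ℕ) :
    DependsOn (fun u => C.output (u, b) i) (Set.Iio (numGenerated ρ (lastReceived b i))) := by
  intro u u' h
  refine congrArg (C.dec i) (funext fun k => ?_)
  by_cases hb : b k
  · simp only [received, hb, if_true]
  · have hprefix : ∀ j : Fin (numGenerated ρ (k + 1)), u j = u' j :=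
      fun j => h j <| Set.mem_Iio.2 <| j.2.trans_le <|
        numGenerated_mono hρ (succ_le_lastReceived k.2 hb)
    simp only [received, hprefix]

end Causality

section ZeroError

variable [Countable U] [MeasurableSpace U] [MeasurableSingletonClass U] {p : Measure U}
  [IsProbabilityMeasure p] {ε : unitInterval} {C : CodingScheme U V ρ}

lemma ZeroError.ae_output_ne (hC : C.ZeroError p ε) (hρ : 0 ≤ ρ) {i : ℕ} (hi : 1 ≤ i) {v : U}
    (hv : p {v} ≠ 1) (j : Fin (numGenerated ρ i)) :
    ∀ᵐ ω ∂(systemLaw p ε),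
      ¬ (C.output ω i = some (v, j) ∧ numGenerated ρ (lastReceived ω.2 i) ≤ j) := by
  refine ae_prod_not_of_ae_imp_eval_eq (n := i) (m := j) (Q := fun u b =>
      C.output (u, b) i = some (v, j) ∧ numGenerated ρ (lastReceived b i) ≤ j)
    hv (fun b u u' h => ?_) (fun u b b' h => ?_) ?_
  · by_cases hj : numGenerated ρ (lastReceived b i) ≤ j
    · have hout : C.output (u, b) i = C.output (u', b) i :=
        C.dependsOn_output_source hρ b i fun k hk => h k (Set.mem_Iio.2 (lt_of_lt_of_le hk hj))
      simp only [hout]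
    · simp only [hj, and_false]
  · have hout : C.output (u, b) i = C.output (u, b') i := C.dependsOn_output_erasures u i h
    have hlast : lastReceived b i = lastReceived b' i := dependsOn_lastReceived i h
    simp only [hout, hlast]
  · filter_upwards [hC] with ω hω hQ using (hω i hi v j hQ.1).symm

theorem ZeroError.ae_freshestIndex_le (hC : C.ZeroError p ε) (hρ : 0 ≤ ρ)
    (hp : ∀ u : U, p {u} ≠ 1) :
    ∀ᵐ ω ∂(systemLaw p ε), ∀ n, C.freshestIndex ω n ≤ numGenerated ρ (lastReceived ω.2 n) := by
  have hne : ∀ᵐ ω ∂(systemLaw p ε), ∀ i : ℕ, 1 ≤ i → ∀ (v : U) (j : Fin (numGenerated ρ i)),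
      ¬ (C.output ω i = some (v, j) ∧ numGenerated ρ (lastReceived ω.2 i) ≤ j) := by
    simp only [ae_all_iff]
    exact fun i hi v j => hC.ae_output_ne hρ hi (hp v) j
  filter_upwards [hne] with ω hω n
  refine Finset.sup_le fun i hi => ?_
  obtain ⟨hi, hin⟩ := Finset.mem_Icc.1 hi
  refine le_trans ?_ (numGenerated_mono hρ (lastReceived_mono ω.2 hin))
  rw [decodedIndex]
  split
  · exact Nat.zero_le _
  · next v j hvj => exact not_le.1 fun hj => hω i hi v j ⟨hvj, hj⟩

end ZeroError

section Uncoded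

variable [Nonempty U] (σ : U ↪ V)

/-- The scheme that always sends the freshest symbol, transcribed by `σ`, and decodes whatever it
receives. -/
noncomputable def uncoded (ρ : ℝ) : CodingScheme U V ρ where
  enc i x := σ (if h : 0 < numGenerated ρ i then x ⟨numGenerated ρ i - 1, Nat.sub_one_lt_of_lt h⟩
    else Classical.arbitrary U)
  dec
    | 0 => fun _ => none
    | i + 1 => fun y => if h : 0 < numGenerated ρ (i + 1) then
        (y (Fin.last i)).map fun v =>
          (Function.invFun σ v, ⟨numGenerated ρ (i + 1) - 1, Nat.sub_one_lt_of_lt h⟩)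
      else none

lemma output_uncoded_succ (ω : Sample U) (i : ℕ) :
    (uncoded σ ρ).output ω (i + 1) =
      if h : 0 < numGenerated ρ (i + 1) then
        if ω.2 i then none else
          some (ω.1 (numGenerated ρ (i + 1) - 1),
            ⟨numGenerated ρ (i + 1) - 1, Nat.sub_one_lt_of_lt h⟩)
      else none := by
  by_cases h : 0 < numGenerated ρ (i + 1)
  · by_cases hb : ω.2 i <;>
      simp [output, received, uncoded, h, hb, Function.leftInverse_invFun σ.injective _]
  · simp [output, uncoded, h]

lemma zeroError_uncoded [MeasurableSpace U] (p : Measure U) (ε : unitInterval) :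
    (uncoded σ ρ).ZeroError p ε := by
  refine Eventually.of_forall fun ω i hi u j h => ?_
  obtain ⟨i, rfl⟩ := Nat.exists_eq_add_of_le' hi
  rw [output_uncoded_succ] at h
  split_ifs at h
  obtain ⟨rfl, rfl⟩ := Prod.mk.inj (Option.some.inj h)
  rfl

lemma decodedIndex_uncoded_succ (ω : Sample U) (i : ℕ) :
    (uncoded σ ρ).decodedIndex ω (i + 1) = if ω.2 i then 0 else numGenerated ρ (i + 1) := by
  rw [decodedIndex, output_uncoded_succ]
  rcases Nat.eq_zero_or_pos (numGenerated ρ (i + 1)) with h | h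
  · simp [h]
  · by_cases hb : ω.2 i
    · simp [hb]
    · simp [h, hb, Nat.sub_add_cancel h]

lemma freshestIndex_uncoded (hρ : 0 ≤ ρ) (ω : Sample U) (n : ℕ) :
    (uncoded σ ρ).freshestIndex ω n = numGenerated ρ (lastReceived ω.2 n) := by
  induction n with
  | zero => simp [freshestIndex, lastReceived, numGenerated]
  | succ n ih =>
    rw [freshestIndex, ← Finset.insert_Icc_right_eq_Icc_add_one n.succ_pos, Finset.sup_insert,
      ← freshestIndex, ih, decodedIndex_uncoded_succ, lastReceived]
    split_ifs
    · exact zero_max _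
    · exact sup_eq_left.2 (numGenerated_mono hρ ((lastReceived_le _ n).trans n.le_succ))

end Uncoded

lemma timeAverage_uncoded [Nonempty U] (σ : U ↪ V) (hρ : 0 ≤ lam / mu) (ω : Sample U) (τ : ℝ) :
    (uncoded σ (lam / mu)).timeAverage ω τ =
      1 / τ * ∫ t in (0 : ℝ)..τ, stepAge mu (deliverableTime lam mu ω.2) t := by
  simp only [timeAverage, age, freshestIndex_uncoded σ hρ, stepAge, deliverableTime]

lemma timeAverage_ge (hlam : 0 ≤ lam) (hmu : 0 ≤ mu) (C : CodingScheme U V (lam / mu))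
    {ω : Sample U}
    (h : ∀ n, C.freshestIndex ω n ≤ numGenerated (lam / mu) (lastReceived ω.2 n))
    {τ : ℝ} (hτ : 0 ≤ τ) :
    1 / τ * ∫ t in (0 : ℝ)..τ, stepAge mu (deliverableTime lam mu ω.2) t ≤ C.timeAverage ω τ :=
  timeAverage_stepAge_anti hmu
    (fun _ _ hmn => div_le_div_of_nonneg_right (Nat.cast_le.2 (C.freshestIndex_mono ω hmn)) hlam)
    (deliverableTime_mono hlam hmu ω.2)
    (fun n => div_le_div_of_nonneg_right (Nat.cast_le.2 (h n)) hlam) hτ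

section AverageAge

variable [MeasurableSpace U] {p : Measure U} {ε : unitInterval} {c : ℝ}

lemma ae_tendsto_timeAverage_deliverableTime_snd (hlam : 0 < lam) (hmu : 0 < mu)
    (hε : (ε : ℝ) < 1) (hc : HasCesaroMean (fun n => Int.fract (n * (lam / mu))) c) :
    ∀ᵐ ω ∂(systemLaw p ε), Tendsto (fun τ : ℝ =>
        ((1 / τ * ∫ t in (0 : ℝ)..τ, stepAge mu (deliverableTime lam mu ω.2) t : ℝ) : EReal)) atTop
      (𝓝 ((c / lam + (1 + ε) / (2 * mu * (1 - ε)) : ℝ) : EReal)) := by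
  have hlim := Measure.quasiMeasurePreserving_snd (μ := Measure.infinitePi fun _ : ℕ => p)
    (ν := erasureLaw ε) |>.ae (ae_tendsto_timeAverage_deliverableTime hlam hmu hε hc)
  filter_upwards [hlim] with ω hω using EReal.tendsto_coe.2 hω

lemma hasAverageAge_uncoded [Nonempty U] (σ : U ↪ V) (hlam : 0 < lam) (hmu : 0 < mu)
    (hε : (ε : ℝ) < 1) (hc : HasCesaroMean (fun n => Int.fract (n * (lam / mu))) c) :
    (uncoded σ (lam / mu)).HasAverageAge p ε
      ((c / lam + (1 + ε) / (2 * mu * (1 - ε)) : ℝ) : EReal) := by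
  filter_upwards [ae_tendsto_timeAverage_deliverableTime_snd hlam hmu hε hc] with ω hω
  simpa only [timeAverage_uncoded σ (div_pos hlam hmu).le] using hω

lemma ZeroError.ae_le_liminf_timeAverage [Countable U] [MeasurableSingletonClass U]
    [IsProbabilityMeasure p] {C : CodingScheme U V (lam / mu)} (hC : C.ZeroError p ε)
    (hp : ∀ u : U, p {u} ≠ 1) (hlam : 0 < lam) (hmu : 0 < mu) (hε : (ε : ℝ) < 1)
    (hc : HasCesaroMean (fun n => Int.fract (n * (lam / mu))) c) :
    ∀ᵐ ω ∂(systemLaw p ε), ((c / lam + (1 + ε) / (2 * mu * (1 - ε)) : ℝ) : EReal) ≤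
      liminf (fun τ : ℝ => (C.timeAverage ω τ : EReal)) atTop := by
  filter_upwards [ae_tendsto_timeAverage_deliverableTime_snd hlam hmu hε hc,
    hC.ae_freshestIndex_le (div_pos hlam hmu).le hp] with ω hlim hω
  rw [← hlim.liminf_eq]
  refine liminf_le_liminf ?_
  filter_upwards [eventually_ge_atTop 0] with τ hτ
  exact EReal.coe_le_coe_iff.2 (C.timeAverage_ge hlam.le hmu.le hω hτ)

end AverageAge

end CodingScheme

section OptimalAge

variable {U V : Type*} [Countable U] [MeasurableSpace U] [MeasurableSingletonClass U]
  {p : Measure U} [IsProbabilityMeasure p] {ε : unitInterval} {lam mu : ℝ}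

theorem optimalAverageAge_eq_of_hasCesaroMean (σ : U ↪ V) (hp : ∀ u : U, p {u} ≠ 1)
    (hε : (ε : ℝ) < 1) (hlam : 0 < lam) (hmu : 0 < mu) {c : ℝ}
    (hc : HasCesaroMean (fun n => Int.fract (n * (lam / mu))) c) :
    optimalAverageAge U V p ε lam mu =
      ((c / lam + (1 + ε) / (2 * mu * (1 - ε)) : ℝ) : EReal) := by
  have : Nonempty U := nonempty_of_isProbabilityMeasure p
  have : IsProbabilityMeasure (systemLaw p ε) := by
    rw [systemLaw]
    infer_instance
  refine le_antisymm (sInf_le ⟨_, CodingScheme.zeroError_uncoded σ p ε,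
    CodingScheme.hasAverageAge_uncoded σ hlam hmu hε hc⟩) (le_sInf ?_)
  rintro a ⟨C, hC, ha⟩
  obtain ⟨ω, hle, hlim⟩ := ((hC.ae_le_liminf_timeAverage hp hlam hmu hε hc).and ha).exists
  rwa [hlim.liminf_eq] at hle

end OptimalAge

lemma exists_hasCesaroMean_fract_mul (ρ : ℝ) :
    ∃ c, HasCesaroMean (fun n => Int.fract (n * ρ)) c := by
  by_cases hρ : Irrational ρ
  · exact ⟨_, hasCesaroMean_fract_mul_irrational hρ⟩
  · obtain ⟨r, rfl⟩ := not_not.1 hρ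
    exact ⟨_, hasCesaroMean_fract_mul_ratCast r⟩

lemma hasCesaroMean_fract_mul_of_coprime {m l : ℕ} (hl : l ≠ 0) (hml : m.Coprime l) :
    HasCesaroMean (fun n => Int.fract (n * ((m : ℝ) / l))) ((l - 1) / (2 * l)) := by
  have hden : (m / l : ℚ).den = l := by
    simpa only [Int.cast_natCast, Nat.cast_inj] using
      Rat.den_div_eq_of_coprime (a := m) (b := l) (by positivity) hml
  simpa [hden] using hasCesaroMean_fract_mul_ratCast (m / l : ℚ)

theorem theorem3_general {U V : Type*} [Countable U] (σ : U ↪ V)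
    [MeasurableSpace U] [MeasurableSingletonClass U]
    (p : Measure U) [IsProbabilityMeasure p] (hp : ∀ u : U, p {u} ≠ 1)
    (ε : unitInterval) (hε : (ε : ℝ) < 1)
    (lam mu : ℝ) (hlam : 0 < lam) (hmu : 0 < mu) :
    (Irrational (lam / mu) →
      optimalAverageAge U V p ε lam mu =
        ((1 / (2 * lam) + (1 + (ε : ℝ)) / (2 * mu * (1 - (ε : ℝ))) : ℝ) : EReal)) ∧
    (∀ m l : ℕ, l ≠ 0 → Nat.Coprime m l → lam / mu = (m : ℝ) / (l : ℝ) →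
      optimalAverageAge U V p ε lam mu =
        ((((l : ℝ) - 1) / (2 * (l : ℝ) * lam) +
          (1 + (ε : ℝ)) / (2 * mu * (1 - (ε : ℝ))) : ℝ) : EReal)) ∧
    (∃ C : CodingScheme U V (lam / mu),
      C.ZeroError p ε ∧ C.HasAverageAge p ε (optimalAverageAge U V p ε lam mu)) ∧
    (∀ C : CodingScheme U V (lam / mu), C.ZeroError p ε →
      ∀ᵐ ω ∂(systemLaw p ε),
        optimalAverageAge U V p ε lam mu ≤
          liminf (fun τ : ℝ => (C.timeAverage ω τ : EReal)) atTop) := by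
  have : Nonempty U := nonempty_of_isProbabilityMeasure p
  obtain ⟨c, hc⟩ := exists_hasCesaroMean_fract_mul (lam / mu)
  refine ⟨fun hirr => ?_, fun m l hl hml h => ?_, ?_, fun C hC => ?_⟩
  · rw [optimalAverageAge_eq_of_hasCesaroMean σ hp hε hlam hmu
      (hasCesaroMean_fract_mul_irrational hirr), div_div]
  · rw [optimalAverageAge_eq_of_hasCesaroMean σ hp hε hlam hmu
      (h ▸ hasCesaroMean_fract_mul_of_coprime hl hml), div_div]
  · rw [optimalAverageAge_eq_of_hasCesaroMean σ hp hε hlam hmu hc]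
    exact ⟨_, CodingScheme.zeroError_uncoded σ p ε,
      CodingScheme.hasAverageAge_uncoded σ hlam hmu hε hc⟩
  · rw [optimalAverageAge_eq_of_hasCesaroMean σ hp hε hlam hmu hc]
    exact hC.ae_le_liminf_timeAverage hp hlam hmu hε hc

theorem theorem3 {U V : Type*} [Fintype U] [Fintype V]
    (hUV : Fintype.card U = Fintype.card V)
    [MeasurableSpace U] [MeasurableSingletonClass U]
    (p : Measure U) [IsProbabilityMeasure p] (hp : ∀ u : U, p {u} ≠ 1)
    (ε : unitInterval) (hε : (ε : ℝ) < 1)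
    (lam mu : ℝ) (hlam : 0 < lam) (hmu : 0 < mu) :
    -- the value for irrational utilization
    (Irrational (lam / mu) →
      optimalAverageAge U V p ε lam mu =
        ((1 / (2 * lam) + (1 + (ε : ℝ)) / (2 * mu * (1 - (ε : ℝ))) : ℝ) : EReal)) ∧
    -- the value for rational utilization
    (∀ m l : ℕ, l ≠ 0 → Nat.Coprime m l → lam / mu = (m : ℝ) / (l : ℝ) →
      optimalAverageAge U V p ε lam mu =
        ((((l : ℝ) - 1) / (2 * (l : ℝ) * lam) +
          (1 + (ε : ℝ)) / (2 * mu * (1 - (ε : ℝ))) : ℝ) : EReal)) ∧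
    -- the infimum is attained
    (∃ C : CodingScheme U V (lam / mu),
      C.ZeroError p ε ∧ C.HasAverageAge p ε (optimalAverageAge U V p ε lam mu)) ∧
    -- no scheme does better, even one whose time averages do not converge
    (∀ C : CodingScheme U V (lam / mu), C.ZeroError p ε →
      ∀ᵐ ω ∂(systemLaw p ε),
        optimalAverageAge U V p ε lam mu ≤
          liminf (fun τ : ℝ => (C.timeAverage ω τ : EReal)) atTop) :=
  theorem3_general (Fintype.equivOfCardEq hUV).toEmbedding p hp ε hε lam mu hlam hmu
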